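/- Let $\mathbb{H}=\mathbb{R}^2\times\mathbb{R}$ be the first Heisenberg group, with group law $$(v,z)\cdot(v',z')=\Bigl(v+v',\,z+z'+\tfrac12(v_1v_2'-v_2v_1')\Bigr)$$ and dilations $\delta_t(v,z)=(tv,t^2z)$, $t>0$; let $0=(0,0)$ denote its identity element and $\|\cdot\|$ the Euclidean norm on $\mathbb{R}^2$. A distance $d$ on $\mathbb{H}$ is called homogeneous if $d(p\cdot q,p\cdot q')=d(q,q')$ and $d(\delta_t(p),\delta_t(q))=t\,d(p,q)$ for all $p,q,q'\in\mathbb{H}$ and $t>0$. In a metric space $(X,d)$, balls are the closed balls $B(p,r)=\{q\in X: d(p,q)\le r\}$ with $0<r<\infty$. A Besicovitch family of balls is a family $\mathcal{B}$ of balls, each ball $B\in\mathcal{B}$ having center $p_B$, such that $p_B\notin B'$ for all $B,B'\in\mathcal{B}$ with $B\neq B'$, and $\bigcap_{B\in\mathcal{B}}B\neq\emptyset$. The space $(X,d)$ satisfies the Besicovitch Covering Property (BCP) if there is a constant $C\ge 1$ such that $\operatorname{Card}\mathcal{B}\le C$ for every Besicovitch family of balls $\mathcal{B}$ in $(X,d)$.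 Define the Korányi distance $d_0$ and, for every $\varepsilon>0$, the distance $d_\varepsilon$ by $d_0(p,q)=d_0(0,p^{-1}\cdot q)$, $d_\varepsilon(p,q)=d_\varepsilon(0,p^{-1}\cdot q)$ and $$d_0(0,(v,z))=\bigl(\|v\|^4+16z^2\bigr)^{1/4},\qquad d_\varepsilon(0,(v,z))=\bigl(\varepsilon^2\|v\|^2+d_0(0,(v,z))^2\bigr)^{1/2}.$$ **Theorem.** For every $\varepsilon>0$, $d_\varepsilon$ is a homogeneous distance on $\mathbb{H}$, BCP holds in $(\mathbb{H},d_\varepsilon)$, and $d_0\le d_\varepsilon\le(1+\varepsilon)\,d_0$ on $\mathbb{H}\times\mathbb{H}$. On the other hand, $d_0$ is a homogeneous distance on $\mathbb{H}$ and BCP does not hold in $(\mathbb{H},d_0)$. -/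

import Mathlib

noncomputable section

/-- `d` is a distance (a metric) on the set `X`. -/
structure IsDistance {X : Type*} (d : X → X → ℝ) : Prop where
  nonneg : ∀ p q, 0 ≤ d p q
  eq_zero_iff : ∀ p q, d p q = 0 ↔ p = q
  symm : ∀ p q, d p q = d q p
  triangle : ∀ p q r, d p r ≤ d p q + d q r

/-- The closed ball `B(p, r) = {q : d(p, q) ≤ r}` for the distance `d`. -/
def ball {X : Type*} (d : X → X → ℝ) (p : X) (r : ℝ) : Set X :=
  {q | d p q ≤ r}

/-- A Besicovitch family of balls for the distance `d`: a set `𝓑` of closed balls of positive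
finite radius, each `B ∈ 𝓑` with a center `center B`, such that the center of a ball of the family
lies in no other ball of the family, and such that all the balls of the family have a common
point. -/
def IsBesicovitchFamily {X : Type*} (d : X → X → ℝ) (𝓑 : Set (Set X)) : Prop :=
  ∃ (center : Set X → X) (radius : Set X → ℝ),
    (∀ B ∈ 𝓑, 0 < radius B ∧ B = ball d (center B) (radius B)) ∧
    (∀ B ∈ 𝓑, ∀ B' ∈ 𝓑, B ≠ B' → center B ∉ B') ∧
    (⋂ B ∈ 𝓑, B).Nonempty

/-- The Besicovitch covering property for the distance `d` on `X`: the cardinality of the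
Besicovitch families of balls (finite or infinite, a priori) is bounded by a constant. -/
def SatisfiesBCP {X : Type*} (d : X → X → ℝ) : Prop :=
  ∃ C : ℕ, 1 ≤ C ∧ ∀ 𝓑 : Set (Set X), IsBesicovitchFamily d 𝓑 → 𝓑.encard ≤ (C : ℕ∞)

/-- The first Heisenberg group, as the set `ℝ² × ℝ` of the points `(v, z)`; `ℝ²` carries the
Euclidean norm. -/
@[ext]
structure Heisenberg where
  v : EuclideanSpace ℝ (Fin 2)
  z : ℝ

namespace Heisenberg

/-- `ω(v, v') = v₁ v'₂ - v₂ v'₁`. -/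
def omega (v w : EuclideanSpace ℝ (Fin 2)) : ℝ :=
  v 0 * w 1 - v 1 * w 0

/-- The group law `(v, z) · (v', z') = (v + v', z + z' + ω(v, v') / 2)`. -/
instance : Mul Heisenberg :=
  ⟨fun p q => ⟨p.v + q.v, p.z + q.z + omega p.v q.v / 2⟩⟩

/-- The identity element is the origin `(0, 0)`. -/
instance : One Heisenberg := ⟨⟨0, 0⟩⟩

/-- The inverse of `(v, z)` is `(-v, -z)`. -/
instance : Inv Heisenberg := ⟨fun p => ⟨-p.v, -p.z⟩⟩

@[simp] theorem mul_v (p q : Heisenberg) : (p * q).v = p.v + q.v := rfl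

@[simp] theorem mul_z (p q : Heisenberg) :
    (p * q).z = p.z + q.z + omega p.v q.v / 2 := rfl

@[simp] theorem one_v : (1 : Heisenberg).v = 0 := rfl

@[simp] theorem one_z : (1 : Heisenberg).z = 0 := rfl

@[simp] theorem inv_v (p : Heisenberg) : p⁻¹.v = -p.v := rfl

@[simp] theorem inv_z (p : Heisenberg) : p⁻¹.z = -p.z := rfl

instance : Group Heisenberg :=
  Group.ofLeftAxioms
    (by
      intro p q r
      ext1
      · simp [add_assoc]
      · simp [omega]
        ring)
    (by
      intro p
      ext1 <;> simp [omega])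
    (by
      intro p
      ext1
      · simp
      · simp [omega]
        ring)

/-- The dilation `δ_t(v, z) = (t v, t² z)`. -/
def dilation (t : ℝ) (p : Heisenberg) : Heisenberg :=
  ⟨t • p.v, t ^ 2 * p.z⟩

/-- A homogeneous distance on the Heisenberg group: a distance that is left-invariant and
one-homogeneous with respect to the dilations. -/
structure IsHomogeneousDistance (d : Heisenberg → Heisenberg → ℝ) : Prop where
  isDistance : IsDistance d
  left_invariant : ∀ p q q', d (p * q) (p * q') = d q q'
  homogeneous : ∀ t : ℝ, 0 < t → ∀ p q, d (dilation t p) (dilation t q) = t * d p q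

/-- `d₀(0, (v, z)) = (‖v‖⁴ + 16 z²)^(1/4)`. -/
def koranyiGauge (p : Heisenberg) : ℝ :=
  (‖p.v‖ ^ 4 + 16 * p.z ^ 2) ^ (1 / 4 : ℝ)

/-- The Korányi distance `d₀`, with `d₀(p, q) = d₀(0, p⁻¹ · q)`. -/
def koranyiDist (p q : Heisenberg) : ℝ :=
  koranyiGauge (p⁻¹ * q)

/-- `d_ε(0, (v, z)) = (ε² ‖v‖² + d₀(0, (v, z))²)^(1/2)`. -/
def epsGauge (ε : ℝ) (p : Heisenberg) : ℝ :=
  Real.sqrt (ε ^ 2 * ‖p.v‖ ^ 2 + koranyiGauge p ^ 2)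

/-- The distance `d_ε`, with `d_ε(p, q) = d_ε(0, p⁻¹ · q)`. -/
def epsDist (ε : ℝ) (p q : Heisenberg) : ℝ :=
  epsGauge ε (p⁻¹ * q)

end Heisenberg

end

/-! All estimates use the complex number `zeta p`, whose modulus is the squared Korányi gauge and
whose product formula has the cross term `2 (dot + i omega)`.

For `epsDist`, the centers are moved by left invariance so that the common point is the identity,
then coloured by the sign of `z`, a capped slope `4|z| / ‖v‖²` and a narrow angular sector of `v`.
Two points of the same colour are at distance at most the gauge of one of them. Replacing nearly
parallel vectors by parallel ones costs `4 η dot`, and for `‖q.v‖ ≤ ‖p.v‖` the `ε`-term gains at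
least `ε² dot / 2`, which absorbs this cost (`epsDist_le_of_norm_le`). Steep points are handled by
their vertical parts (`epsDist_le_of_hasSlope_self`).

For `koranyiDist` there is no such gain. Slightly rotated points with large `z`, placed at widely
separated scales, have a twist `omega` that pushes them apart to first order in the scale ratio
(`koranyiGauge_lt_koranyiDist_slantedPoint`), which gives Besicovitch families of every size. -/

/-! ### Besicovitch families -/

/-- A distance satisfies the Besicovitch covering property as soon as, for every base point `o`,
the points can be coloured with finitely many colours so that two points of the same colour are at
most as far from each other as one of them is from `o`. -/
theorem satisfiesBCP_of_finite_coloring {X ι : Type*} [Finite ι] {d : X → X → ℝ}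
    (hd : IsDistance d) (f : X → X → ι)
    (h : ∀ o p q, f o p = f o q → d p q ≤ d p o ∨ d p q ≤ d q o) : SatisfiesBCP d := by
  -- The `+ 1` only secures `1 ≤ C`, since `ι` may be empty.
  refine ⟨Nat.card ι + 1, by omega, fun 𝓑 h𝓑 => ?_⟩
  obtain ⟨c, r, hB, hc, o, ho⟩ := h𝓑
  have ho' : ∀ B ∈ 𝓑, d (c B) o ≤ r B := by
    intro B hBm
    have h1 : o ∈ B := Set.mem_iInter₂.1 ho B hBm
    rw [(hB B hBm).2] at h1
    exact h1
  have hinj : Set.InjOn (fun B => f o (c B)) 𝓑 := by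
    intro B hBm B' hBm' heq
    by_contra hne
    rcases h o _ _ heq with h1 | h1
    · apply hc B' hBm' B hBm (Ne.symm hne)
      rw [(hB B hBm).2]
      exact h1.trans (ho' B hBm)
    · apply hc B hBm B' hBm' hne
      rw [(hB B' hBm').2]
      change d (c B') (c B) ≤ r B'
      rw [hd.symm]
      exact h1.trans (ho' B' hBm')
  calc 𝓑.encard = ((fun B => f o (c B)) '' 𝓑).encard := hinj.encard_image.symm
    _ ≤ (Set.univ : Set ι).encard := Set.encard_le_encard (Set.subset_univ _)
    _ = (Nat.card ι : ℕ∞) := by rw [Set.encard_univ, ENat.card_eq_coe_natCard]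
    _ ≤ ((Nat.card ι + 1 : ℕ) : ℕ∞) := by exact_mod_cast Nat.le_succ _

/-- Points which are all further from each other than from a common point `o` violate the
Besicovitch covering property, if there are arbitrarily many of them. -/
theorem not_satisfiesBCP_of_forall_points {X : Type*} {d : X → X → ℝ} (hd : IsDistance d) (o : X)
    (h : ∀ n : ℕ, 1 ≤ n → ∃ P : ℕ → X, (∀ i, 0 < d (P i) o) ∧
      ∀ i ≤ n, ∀ j ≤ n, i ≠ j → d (P i) o < d (P i) (P j)) : ¬ SatisfiesBCP d := by
  rintro ⟨C, hC, hfam⟩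
  obtain ⟨P, hpos, hP⟩ := h C hC
  let b : ℕ → Set X := fun i => ball d (P i) (d (P i) o)
  have hself : ∀ i, P i ∈ b i := by
    intro i
    change d (P i) (P i) ≤ _
    rw [(hd.eq_zero_iff _ _).2 rfl]
    exact hd.nonneg _ _
  have hne : ∀ i ≤ C, ∀ j ≤ C, i ≠ j → P j ∉ b i :=
    fun i hi j hj hij hmem => absurd (hP i hi j hj hij) (not_lt.2 hmem)
  have hinj : Set.InjOn b (Set.Iic C) := by
    intro i hi j hj hij
    by_contra hcon
    exact hne i hi j hj hcon (hij ▸ hself j)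
  -- Centers and radii are functions of the ball as a set, so an index is recovered from it. The
  -- indices `0, …, C` give `C + 1` distinct balls.
  let idx : Set X → ℕ := Function.invFunOn b (Set.Iic C)
  have hidx : ∀ B ∈ b '' Set.Iic C, idx B ∈ Set.Iic C ∧ b (idx B) = B :=
    fun B hB => ⟨Function.invFunOn_mem hB, Function.invFunOn_eq hB⟩
  have hcard := hfam (b '' Set.Iic C) ⟨fun B => P (idx B), fun B => d (P (idx B)) o, ?_, ?_, o, ?_⟩
  · rw [hinj.encard_image, ← Finset.coe_Iic, Set.encard_coe_eq_coe_finsetCard, Nat.card_Iic] at hcard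
    have : C + 1 ≤ C := by exact_mod_cast hcard
    omega
  · exact fun B hB => ⟨hpos _, (hidx B hB).2.symm⟩
  · intro B hB B' hB' hBB hmem
    obtain ⟨h1, h2⟩ := hidx B hB
    obtain ⟨h3, h4⟩ := hidx B' hB'
    rw [← h4] at hmem
    refine hne _ h3 _ h1 (fun heq => hBB ?_) hmem
    rw [← h2, ← h4, heq]
  · simp only [Set.mem_iInter]
    rintro B ⟨i, -, rfl⟩
    exact le_refl (d (P i) o)

namespace Heisenberg

/-! ### The complex gauge -/

/-- The complex number `‖v‖² + 4 i z`, whose modulus is the square of the Korányi gauge. -/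
noncomputable def zeta (p : Heisenberg) : ℂ := ⟨‖p.v‖ ^ 2, 4 * p.z⟩

/-- The inner product of `ℝ²` in coordinates. -/
def dot (v w : EuclideanSpace ℝ (Fin 2)) : ℝ := v 0 * w 0 + v 1 * w 1

theorem norm_sq_eq_coord (v : EuclideanSpace ℝ (Fin 2)) : ‖v‖ ^ 2 = v 0 ^ 2 + v 1 ^ 2 := by
  simp [EuclideanSpace.norm_sq_eq, Fin.sum_univ_two]

theorem dot_sq_add_omega_sq (v w : EuclideanSpace ℝ (Fin 2)) :
    dot v w ^ 2 + omega v w ^ 2 = (‖v‖ * ‖w‖) ^ 2 := by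
  rw [mul_pow, norm_sq_eq_coord, norm_sq_eq_coord, dot, omega]
  ring

theorem zeta_mul (p q : Heisenberg) :
    zeta (p * q) = zeta p + zeta q + 2 * ⟨dot p.v q.v, omega p.v q.v⟩ := by
  apply Complex.ext
  · simp only [zeta, mul_v, norm_sq_eq_coord, dot, PiLp.add_apply, Complex.add_re, Complex.mul_re,
      Complex.re_ofNat, Complex.im_ofNat]
    ring
  · simp only [zeta, mul_z, Complex.add_im, Complex.mul_im, Complex.re_ofNat, Complex.im_ofNat]
    ring

theorem zeta_inv (p : Heisenberg) : zeta p⁻¹ = (starRingEnd ℂ) (zeta p) := by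
  apply Complex.ext <;> simp [zeta]

theorem zeta_dilation (t : ℝ) (p : Heisenberg) : zeta (dilation t p) = (t ^ 2 : ℝ) * zeta p := by
  apply Complex.ext
  · rw [Complex.re_ofReal_mul]
    simp [zeta, dilation, norm_smul, mul_pow]
  · rw [Complex.im_ofReal_mul]
    simp only [zeta, dilation]
    ring

theorem zeta_inv_mul (p q : Heisenberg) :
    zeta (p⁻¹ * q) = ⟨‖p.v‖ ^ 2 + ‖q.v‖ ^ 2 - 2 * dot p.v q.v,
      4 * (q.z - p.z) - 2 * omega p.v q.v⟩ := by
  apply Complex.ext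
  · simp only [zeta, mul_v, inv_v, norm_sq_eq_coord, dot, PiLp.add_apply, PiLp.neg_apply]
    ring
  · simp only [zeta, mul_z, inv_v, inv_z, omega, PiLp.neg_apply]
    ring

theorem norm_zeta (p : Heisenberg) : ‖zeta p‖ = √(‖p.v‖ ^ 4 + 16 * p.z ^ 2) := by
  rw [Complex.norm_eq_sqrt_sq_add_sq]
  congr 1
  simp only [zeta]
  ring

theorem koranyiGauge_eq_sqrt (p : Heisenberg) : koranyiGauge p = √‖zeta p‖ := by
  rw [norm_zeta, koranyiGauge, Real.sqrt_eq_rpow, Real.sqrt_eq_rpow, ← Real.rpow_mul (by positivity)]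
  norm_num

theorem koranyiGauge_nonneg (p : Heisenberg) : 0 ≤ koranyiGauge p := by
  rw [koranyiGauge_eq_sqrt]
  positivity

theorem koranyiGauge_sq (p : Heisenberg) : koranyiGauge p ^ 2 = ‖zeta p‖ := by
  rw [koranyiGauge_eq_sqrt, Real.sq_sqrt (norm_nonneg _)]

theorem norm_le_koranyiGauge (p : Heisenberg) : ‖p.v‖ ≤ koranyiGauge p := by
  refine abs_le_of_sq_le_sq' ?_ (koranyiGauge_nonneg p) |>.2
  rw [koranyiGauge_sq]
  exact (le_abs_self _).trans (Complex.abs_re_le_norm (zeta p))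

theorem koranyiGauge_eq_zero_iff (p : Heisenberg) : koranyiGauge p = 0 ↔ p = 1 := by
  rw [koranyiGauge_eq_sqrt, Real.sqrt_eq_zero (norm_nonneg _), norm_eq_zero, Complex.ext_iff,
    Heisenberg.ext_iff]
  simp [zeta]

theorem koranyiGauge_inv (p : Heisenberg) : koranyiGauge p⁻¹ = koranyiGauge p := by
  rw [koranyiGauge_eq_sqrt, koranyiGauge_eq_sqrt, zeta_inv, Complex.norm_conj]

theorem koranyiGauge_dilation {t : ℝ} (ht : 0 ≤ t) (p : Heisenberg) :
    koranyiGauge (dilation t p) = t * koranyiGauge p := by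
  rw [koranyiGauge_eq_sqrt, koranyiGauge_eq_sqrt, zeta_dilation, norm_mul, Complex.norm_real,
    Real.norm_of_nonneg (by positivity), Real.sqrt_mul (by positivity), Real.sqrt_sq ht]

/-- Cygan's inequality. -/
theorem koranyiGauge_mul_le (p q : Heisenberg) :
    koranyiGauge (p * q) ≤ koranyiGauge p + koranyiGauge q := by
  have hp := koranyiGauge_nonneg p
  have hq := koranyiGauge_nonneg q
  refine abs_le_of_sq_le_sq' ?_ (add_nonneg hp hq) |>.2
  -- The cross term of `zeta_mul` thus has modulus at most twice the product of the gauges, and the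
  -- triangle inequality in `ℂ` yields the square of the sum.
  have hcross : ‖(⟨dot p.v q.v, omega p.v q.v⟩ : ℂ)‖ = ‖p.v‖ * ‖q.v‖ := by
    rw [Complex.norm_eq_sqrt_sq_add_sq, dot_sq_add_omega_sq, Real.sqrt_sq (by positivity)]
  have hle : ‖p.v‖ * ‖q.v‖ ≤ koranyiGauge p * koranyiGauge q :=
    mul_le_mul (norm_le_koranyiGauge p) (norm_le_koranyiGauge q) (norm_nonneg _) hp
  have h3 := norm_add₃_le (a := zeta p) (b := zeta q)
    (c := 2 * (⟨dot p.v q.v, omega p.v q.v⟩ : ℂ))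
  rw [norm_mul, hcross, ← zeta_mul, ← koranyiGauge_sq, ← koranyiGauge_sq, ← koranyiGauge_sq] at h3
  norm_num at h3
  nlinarith

theorem dilation_inv_mul (t : ℝ) (p q : Heisenberg) :
    (dilation t p)⁻¹ * dilation t q = dilation t (p⁻¹ * q) := by
  ext1
  · simp [dilation]
  · simp [dilation, omega]
    ring

theorem dilation_dilation (s t : ℝ) (p : Heisenberg) :
    dilation s (dilation t p) = dilation (s * t) p := by
  ext1
  · simp [dilation, smul_smul]
  · simp only [dilation]
    ring

/-- The left-invariant distance associated with a homogeneous norm is homogeneous. -/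
theorem isHomogeneousDistance_of_gauge {N : Heisenberg → ℝ} (hnonneg : ∀ p, 0 ≤ N p)
    (hzero : ∀ p, N p = 0 ↔ p = 1) (hinv : ∀ p, N p⁻¹ = N p)
    (hmul : ∀ p q, N (p * q) ≤ N p + N q)
    (hdil : ∀ t : ℝ, 0 < t → ∀ p, N (dilation t p) = t * N p) :
    IsHomogeneousDistance fun p q => N (p⁻¹ * q) where
  isDistance :=
    { nonneg := fun p q => hnonneg _
      eq_zero_iff := fun p q => by rw [hzero, inv_mul_eq_one]
      symm := fun p q => by rw [← hinv (p⁻¹ * q), mul_inv_rev, inv_inv]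
      triangle := fun p q r => by
        have := hmul (p⁻¹ * q) (q⁻¹ * r)
        rwa [mul_assoc, mul_inv_cancel_left] at this }
  left_invariant := fun p q q' => by
    rw [mul_inv_rev, mul_assoc, inv_mul_cancel_left]
  homogeneous := fun t ht p q => by
    rw [dilation_inv_mul, hdil t ht]

theorem isHomogeneousDistance_koranyiDist : IsHomogeneousDistance koranyiDist :=
  isHomogeneousDistance_of_gauge koranyiGauge_nonneg koranyiGauge_eq_zero_iff koranyiGauge_inv
    koranyiGauge_mul_le fun _ ht => koranyiGauge_dilation ht.le

/-! ### The perturbed gauge -/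

/-- Both coordinates are nonnegative and subadditive when `ε ≥ 0`, so the triangle inequality for
the gauge follows from that of `ℂ`. -/
theorem epsGauge_eq_norm (ε : ℝ) (p : Heisenberg) :
    epsGauge ε p = ‖(⟨ε * ‖p.v‖, koranyiGauge p⟩ : ℂ)‖ := by
  rw [Complex.norm_eq_sqrt_sq_add_sq, epsGauge, mul_pow]

theorem koranyiGauge_le_epsGauge (ε : ℝ) (p : Heisenberg) : koranyiGauge p ≤ epsGauge ε p := by
  rw [epsGauge_eq_norm]
  exact (le_abs_self _).trans
    (Complex.abs_im_le_norm (⟨ε * ‖p.v‖, koranyiGauge p⟩ : ℂ))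

theorem epsGauge_le {ε : ℝ} (hε : 0 ≤ ε) (p : Heisenberg) :
    epsGauge ε p ≤ (1 + ε) * koranyiGauge p := by
  have h := norm_le_koranyiGauge p
  have hN := koranyiGauge_nonneg p
  rw [epsGauge_eq_norm]
  refine (Complex.norm_le_abs_re_add_abs_im _).trans ?_
  simp only
  rw [abs_of_nonneg (mul_nonneg hε (norm_nonneg _)), abs_of_nonneg hN]
  nlinarith

theorem norm_mk_le_norm_mk {x y x' y' : ℝ} (hx : |x| ≤ |x'|) (hy : |y| ≤ |y'|) :
    ‖(⟨x, y⟩ : ℂ)‖ ≤ ‖(⟨x', y'⟩ : ℂ)‖ := by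
  rw [Complex.norm_eq_sqrt_sq_add_sq, Complex.norm_eq_sqrt_sq_add_sq]
  exact Real.sqrt_le_sqrt (add_le_add (sq_le_sq.2 hx) (sq_le_sq.2 hy))

theorem epsGauge_mul_le {ε : ℝ} (hε : 0 ≤ ε) (p q : Heisenberg) :
    epsGauge ε (p * q) ≤ epsGauge ε p + epsGauge ε q := by
  simp only [epsGauge_eq_norm]
  refine le_trans ?_ (norm_add_le _ _)
  have hp := koranyiGauge_nonneg p
  have hq := koranyiGauge_nonneg q
  apply norm_mk_le_norm_mk
  · simp only
    rw [abs_of_nonneg (by positivity), abs_of_nonneg (by positivity), ← mul_add]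
    exact mul_le_mul_of_nonneg_left (norm_add_le _ _) hε
  · simp only
    rw [abs_of_nonneg (koranyiGauge_nonneg _), abs_of_nonneg (by positivity)]
    exact koranyiGauge_mul_le p q

theorem epsGauge_dilation (ε : ℝ) {t : ℝ} (ht : 0 ≤ t) (p : Heisenberg) :
    epsGauge ε (dilation t p) = t * epsGauge ε p := by
  rw [epsGauge, epsGauge, koranyiGauge_dilation ht, dilation, norm_smul, Real.norm_of_nonneg ht]
  rw [show ε ^ 2 * (t * ‖p.v‖) ^ 2 + (t * koranyiGauge p) ^ 2
    = t ^ 2 * (ε ^ 2 * ‖p.v‖ ^ 2 + koranyiGauge p ^ 2) by ring, Real.sqrt_mul (by positivity),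
    Real.sqrt_sq ht]

theorem epsGauge_eq_zero_iff {ε : ℝ} (hε : 0 ≤ ε) (p : Heisenberg) :
    epsGauge ε p = 0 ↔ p = 1 := by
  rw [← koranyiGauge_eq_zero_iff]
  have h1 := koranyiGauge_le_epsGauge ε p
  have h2 := epsGauge_le hε p
  have h3 := koranyiGauge_nonneg p
  constructor <;> intro h <;> rw [h] at h1 h2
  · linarith
  · linarith

theorem isHomogeneousDistance_epsDist {ε : ℝ} (hε : 0 ≤ ε) : IsHomogeneousDistance (epsDist ε) :=
  isHomogeneousDistance_of_gauge (fun p => Real.sqrt_nonneg _) (epsGauge_eq_zero_iff hε)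
    (fun p => by simp only [epsGauge, koranyiGauge_inv, inv_v, norm_neg]) (epsGauge_mul_le hε)
    fun _ ht => epsGauge_dilation ε ht.le

/-! ### The covering property for the perturbed distance -/

theorem norm_mk_add_le (x y x' y' : ℝ) :
    ‖(⟨x + x', y + y'⟩ : ℂ)‖ ≤ ‖(⟨x, y⟩ : ℂ)‖ + (|x'| + |y'|) :=
  (norm_add_le (⟨x, y⟩ : ℂ) ⟨x', y'⟩).trans
    (add_le_add_right (Complex.norm_le_abs_re_add_abs_im _) _)

/-- `v` and `w` make an angle whose tangent is at most `η`. -/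
def Aligned (η : ℝ) (v w : EuclideanSpace ℝ (Fin 2)) : Prop :=
  |omega v w| ≤ η * dot v w

theorem Aligned.symm {η : ℝ} {v w : EuclideanSpace ℝ (Fin 2)} (h : Aligned η v w) :
    Aligned η w v := by
  unfold Aligned at *
  rwa [show omega w v = -omega v w by simp only [omega]; ring, abs_neg,
    show dot w v = dot v w by simp only [dot]; ring]

theorem dot_le (v w : EuclideanSpace ℝ (Fin 2)) : dot v w ≤ ‖v‖ * ‖w‖ := by
  refine abs_le_of_sq_le_sq' ?_ (by positivity) |>.2
  rw [← dot_sq_add_omega_sq]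
  exact le_add_of_nonneg_right (sq_nonneg _)

/-- Alignment forces `dot ≥ 0`, and `dot² + omega² ≤ (1 + η²) dot² ≤ ((1 + η) dot)²`. -/
theorem norm_mul_norm_le {η : ℝ} {v w : EuclideanSpace ℝ (Fin 2)} (hη : 0 < η)
    (h : Aligned η v w) : ‖v‖ * ‖w‖ ≤ (1 + η) * dot v w := by
  unfold Aligned at h
  have hdot : 0 ≤ dot v w := by
    by_contra hcon
    nlinarith [abs_nonneg (omega v w)]
  refine abs_le_of_sq_le_sq' ?_ (by positivity) |>.2
  rw [← dot_sq_add_omega_sq, ← sq_abs (omega v w)]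
  nlinarith [abs_nonneg (omega v w), mul_nonneg hη.le (mul_nonneg hdot hdot)]

/-- After squaring, the term `ε² ‖p.v‖²` cancels. -/
theorem epsDist_le_of_zeta {ε : ℝ} {p q : Heisenberg}
    (h : ε ^ 2 * (‖q.v‖ ^ 2 - 2 * dot p.v q.v) + ‖zeta (p⁻¹ * q)‖ ≤ ‖zeta p‖) :
    epsDist ε p q ≤ epsGauge ε p := by
  refine Real.sqrt_le_sqrt ?_
  have hre : ‖(p⁻¹ * q).v‖ ^ 2 = ‖p.v‖ ^ 2 + ‖q.v‖ ^ 2 - 2 * dot p.v q.v :=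
    congrArg Complex.re (zeta_inv_mul p q)
  rw [koranyiGauge_sq, koranyiGauge_sq, hre]
  linarith

theorem norm_zeta_inv_mul_le {η : ℝ} {p q : Heisenberg} (hη : 0 < η)
    (h : Aligned η p.v q.v) :
    ‖zeta (p⁻¹ * q)‖ ≤
      ‖(⟨(‖p.v‖ - ‖q.v‖) ^ 2, 4 * (q.z - p.z)⟩ : ℂ)‖ + 4 * η * dot p.v q.v := by
  have h1 := norm_mul_norm_le hη h
  have h2 := dot_le p.v q.v
  rw [zeta_inv_mul]
  have h3 := norm_mk_add_le ((‖p.v‖ - ‖q.v‖) ^ 2) (4 * (q.z - p.z))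
    (2 * (‖p.v‖ * ‖q.v‖ - dot p.v q.v)) (-2 * omega p.v q.v)
  rw [abs_of_nonneg (by linarith : 0 ≤ 2 * (‖p.v‖ * ‖q.v‖ - dot p.v q.v)), abs_mul] at h3
  unfold Aligned at h
  norm_num at h3
  rw [show ‖p.v‖ ^ 2 + ‖q.v‖ ^ 2 - 2 * dot p.v q.v
    = (‖p.v‖ - ‖q.v‖) ^ 2 + 2 * (‖p.v‖ * ‖q.v‖ - dot p.v q.v) by ring, sub_eq_add_neg _ (2 * _)]
  linarith

theorem epsDist_le_of_norm_le {ε η : ℝ} {p q : Heisenberg} (hη : 0 < η) (hη2 : η ≤ 1 / 2)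
    (hηε : 8 * η ≤ ε ^ 2) (h : Aligned η p.v q.v) (hqp : ‖q.v‖ ≤ ‖p.v‖)
    (hz : ‖(⟨(‖p.v‖ - ‖q.v‖) ^ 2, 4 * (q.z - p.z)⟩ : ℂ)‖ ≤ ‖zeta p‖) :
    epsDist ε p q ≤ epsGauge ε p := by
  apply epsDist_le_of_zeta
  have h1 := norm_mul_norm_le hη h
  have h2 := dot_le p.v q.v
  have h3 := norm_zeta_inv_mul_le hη h
  have h4 : 0 ≤ dot p.v q.v := by
    have := mul_nonneg (norm_nonneg p.v) (norm_nonneg q.v)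
    by_contra hcon
    nlinarith
  have h5 : ‖q.v‖ ^ 2 ≤ ‖p.v‖ * ‖q.v‖ := by nlinarith [norm_nonneg q.v]
  -- Since `‖q.v‖² ≤ (1 + η) dot ≤ (3/2) dot`. Multiplied by `ε² ≥ 8 η`, this pays for the alignment
  -- error `4 η dot`.
  have h6 : ‖q.v‖ ^ 2 - 2 * dot p.v q.v ≤ -(dot p.v q.v / 2) := by nlinarith
  have h7 := mul_le_mul_of_nonneg_left h6 (sq_nonneg ε)
  have h8 := mul_le_mul_of_nonneg_right hηε h4
  linarith

theorem norm_mk_le_norm_zeta {p q : Heisenberg} (hqp : ‖q.v‖ ≤ ‖p.v‖)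
    (hz : |q.z - p.z| ≤ |p.z|) :
    ‖(⟨(‖p.v‖ - ‖q.v‖) ^ 2, 4 * (q.z - p.z)⟩ : ℂ)‖ ≤ ‖zeta p‖ := by
  apply norm_mk_le_norm_mk
  · rw [abs_of_nonneg (sq_nonneg _), abs_of_nonneg (sq_nonneg _)]
    nlinarith [norm_nonneg q.v]
  · rw [abs_mul, abs_mul]
    exact mul_le_mul_of_nonneg_left hz (abs_nonneg _)

theorem abs_sub_le_of_abs_le_two_mul {s z : ℝ} (hsz : 0 ≤ z * s) (h : |s| ≤ 2 * |z|) :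
    |s - z| ≤ |z| := by
  rw [← sq_le_sq]
  have hmul := abs_of_nonneg hsz
  rw [abs_mul] at hmul
  nlinarith [sq_abs s, sq_abs z, abs_nonneg s, abs_nonneg z]

/-- The slope `4|z| / ‖v‖²` of `p` is in `[k, k + 1]`, or at least `K` if `k = K`. -/
def HasSlope (K k : ℕ) (p : Heisenberg) : Prop :=
  k * ‖p.v‖ ^ 2 ≤ 4 * |p.z| ∧ (k < K → 4 * |p.z| ≤ (k + 1) * ‖p.v‖ ^ 2)

theorem exists_hasSlope (K : ℕ) (p : Heisenberg) : ∃ k : Fin (K + 1), HasSlope K k p := by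
  by_cases h : K * ‖p.v‖ ^ 2 ≤ 4 * |p.z|
  -- The vertical axis `v = 0` falls into this capped class.
  · exact ⟨Fin.last K, by simpa using h, by simp⟩
  · have hv : 0 < ‖p.v‖ ^ 2 := by
      by_contra hcon
      have h0 : ‖p.v‖ ^ 2 = 0 := le_antisymm (not_lt.1 hcon) (sq_nonneg _)
      apply h
      rw [h0, mul_zero]
      positivity
    have hx : 0 ≤ 4 * |p.z| / ‖p.v‖ ^ 2 := by positivity
    have h1 := Nat.floor_le hx
    have h2 := (Nat.lt_floor_add_one (4 * |p.z| / ‖p.v‖ ^ 2)).le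
    have h3 : 4 * |p.z| / ‖p.v‖ ^ 2 < K := (div_lt_iff₀ hv).2 (not_le.1 h)
    have h4 := (Nat.floor_lt hx).2 h3
    exact ⟨⟨_, h4.trans (Nat.lt_succ_self K)⟩, (le_div_iff₀ hv).1 h1, fun _ => (div_le_iff₀ hv).1 h2⟩

theorem epsDist_le_of_hasSlope_lt {ε η : ℝ} {p q : Heisenberg} {K k : ℕ} (hη : 0 < η)
    (hη2 : η ≤ 1 / 2) (hηε : 8 * η ≤ ε ^ 2) (h : Aligned η p.v q.v) (hz : 0 ≤ p.z * q.z)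
    (hk : k < K) (hp : HasSlope K k p) (hq : HasSlope K k q) (hqp : ‖q.v‖ ≤ ‖p.v‖) :
    epsDist ε p q ≤ epsGauge ε p := by
  apply epsDist_le_of_norm_le hη hη2 hηε h hqp
  by_cases hs : |q.z| ≤ 2 * |p.z|
  · exact norm_mk_le_norm_zeta hqp (abs_sub_le_of_abs_le_two_mul hz hs)
  rw [not_le] at hs
  have hp1 := hp.1
  have hq2 := hq.2 hk
  have hq0 := norm_nonneg q.v
  have hsq : ‖q.v‖ ^ 2 ≤ ‖p.v‖ * ‖q.v‖ := by nlinarith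
  have hsq' : ‖q.v‖ ^ 2 ≤ ‖p.v‖ ^ 2 := pow_le_pow_left₀ hq0 hqp 2
  -- Here `|q.z| > 2|p.z|`. For `k = 0`, `4|q.z| ≤ ‖q.v‖²` makes the vertical part small enough for
  -- `‖p.v‖²` alone to dominate. For `k ≥ 1`, `4|q.z| > 2k ‖p.v‖² ≥ (k + 1) ‖q.v‖²` contradicts the
  -- slope of `q`.
  rcases Nat.eq_zero_or_pos k with rfl | hkpos
  · norm_num at hq2
    have h1 : |q.z - p.z| ≤ |q.z| := by
      rw [abs_sub_comm]
      exact abs_sub_le_of_abs_le_two_mul (by linarith) (by linarith [abs_nonneg p.z])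
    refine (Complex.norm_le_abs_re_add_abs_im _).trans ?_
    refine le_trans ?_ ((le_abs_self _).trans (Complex.abs_re_le_norm (zeta p)))
    simp only [zeta]
    rw [abs_of_nonneg (sq_nonneg _), abs_mul, abs_of_nonneg (by norm_num : (0 : ℝ) ≤ 4)]
    nlinarith
  · exfalso
    have hk1 : (1 : ℝ) ≤ k := by exact_mod_cast hkpos
    nlinarith [sq_nonneg ‖p.v‖, mul_le_mul_of_nonneg_left hsq' (by positivity : (0 : ℝ) ≤ k + 1)]

theorem epsDist_le_of_hasSlope_self {ε η : ℝ} {p q : Heisenberg} {K : ℕ} (hη : 0 < η)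
    (hη2 : η ≤ 1 / 2) (hηε : 8 * η ≤ ε ^ 2) (h : Aligned η p.v q.v) (hz : 0 ≤ p.z * q.z)
    (hK : ε ^ 2 + 3 ≤ K) (hq : HasSlope K K q) (hqp : |q.z| ≤ |p.z|) :
    epsDist ε p q ≤ epsGauge ε p := by
  rcases le_total ‖q.v‖ ‖p.v‖ with hv | hv
  · exact epsDist_le_of_norm_le hη hη2 hηε h hv (norm_mk_le_norm_zeta hv
      (abs_sub_le_of_abs_le_two_mul hz (by linarith [abs_nonneg p.z])))
  apply epsDist_le_of_zeta
  have hq1 := hq.1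
  have h1 := norm_mul_norm_le hη h
  have h2 := dot_le p.v q.v
  have h3 := norm_zeta_inv_mul_le hη h
  have hp0 := norm_nonneg p.v
  have h4 : 0 ≤ dot p.v q.v := by
    have := mul_nonneg hp0 (norm_nonneg q.v)
    by_contra hcon
    nlinarith
  have habs : |q.z - p.z| = |p.z| - |q.z| := by
    rw [← abs_of_nonneg (sub_nonneg.2 hqp), ← sq_eq_sq_iff_abs_eq_abs]
    have := abs_of_nonneg hz
    rw [abs_mul] at this
    nlinarith [sq_abs p.z, sq_abs q.z]
  have h5 : ‖(⟨(‖p.v‖ - ‖q.v‖) ^ 2, 4 * (q.z - p.z)⟩ : ℂ)‖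
      ≤ ‖q.v‖ ^ 2 + 4 * (|p.z| - |q.z|) := by
    refine (Complex.norm_le_abs_re_add_abs_im _).trans ?_
    simp only
    rw [abs_of_nonneg (sq_nonneg _), abs_mul, habs, abs_of_nonneg (by norm_num : (0 : ℝ) ≤ 4)]
    nlinarith
  have h6 : 4 * |p.z| ≤ ‖zeta p‖ := by
    refine le_trans (le_of_eq ?_) (Complex.abs_im_le_norm (zeta p))
    simp only [zeta]
    rw [abs_mul, abs_of_nonneg (by norm_num : (0 : ℝ) ≤ 4)]
  have h7 : dot p.v q.v ≤ ‖q.v‖ ^ 2 := by nlinarith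
  -- The saving `4|q.z| ≥ K ‖q.v‖²` covers three costs: `ε² ‖q.v‖²`, `‖q.v‖²` from the real part,
  -- and `4 η dot ≤ 2 ‖q.v‖²`. Hence `K ≥ ε² + 3`.
  have h8 := mul_le_mul_of_nonneg_right hK (sq_nonneg ‖q.v‖)
  have h9 := mul_nonneg (sq_nonneg ε) h4
  have h10 : η * dot p.v q.v ≤ 1 / 2 * ‖q.v‖ ^ 2 := mul_le_mul hη2 h7 h4 (by norm_num)
  linarith

/-- `v` as a complex number. -/
def toComplex (v : EuclideanSpace ℝ (Fin 2)) : ℂ := ⟨v 0, v 1⟩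

theorem aligned_of_arg {δ : ℝ} {v w : EuclideanSpace ℝ (Fin 2)} (hδ : δ ≤ 1)
    (h : |(toComplex w).arg - (toComplex v).arg| ≤ δ) : Aligned (2 * δ) v w := by
  set x := (toComplex w).arg - (toComplex v).arg with hx
  have hv0 : v 0 = ‖toComplex v‖ * Real.cos (toComplex v).arg :=
    (Complex.norm_mul_cos_arg (toComplex v)).symm
  have hv1 : v 1 = ‖toComplex v‖ * Real.sin (toComplex v).arg :=
    (Complex.norm_mul_sin_arg (toComplex v)).symm
  have hw0 : w 0 = ‖toComplex w‖ * Real.cos (toComplex w).arg :=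
    (Complex.norm_mul_cos_arg (toComplex w)).symm
  have hw1 : w 1 = ‖toComplex w‖ * Real.sin (toComplex w).arg :=
    (Complex.norm_mul_sin_arg (toComplex w)).symm
  have hom : omega v w = ‖toComplex v‖ * ‖toComplex w‖ * Real.sin x := by
    rw [omega, hv0, hv1, hw0, hw1, hx, Real.sin_sub]
    ring
  have hdot : dot v w = ‖toComplex v‖ * ‖toComplex w‖ * Real.cos x := by
    rw [dot, hv0, hv1, hw0, hw1, hx, Real.cos_sub]
    ring
  have hsin : |Real.sin x| ≤ δ := (Real.abs_sin_le_abs).trans h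
  have hcos : 1 / 2 ≤ Real.cos x := by
    have := Real.one_sub_sq_div_two_le_cos (x := x)
    nlinarith [sq_abs x, abs_nonneg x]
  have hδ0 : 0 ≤ δ := (abs_nonneg _).trans h
  unfold Aligned
  rw [hom, hdot, abs_mul, abs_of_nonneg (by positivity), mul_left_comm]
  refine mul_le_mul_of_nonneg_left ?_ (by positivity)
  nlinarith

/-- The plane is a finite union of sectors of small aperture. -/
theorem exists_sectors {η : ℝ} (hη : 0 < η) (hη2 : η ≤ 1 / 2) :
    ∃ (m : ℤ) (f : EuclideanSpace ℝ (Fin 2) → Finset.Icc (-m) m),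
      ∀ v w, f v = f w → Aligned η v w := by
  -- Sectors have aperture `η / 2`, as `aligned_of_arg` doubles the angle; `4` stands in for `π`.
  have hbd : ∀ θ : ℝ, |θ| ≤ Real.pi → ⌊θ * (2 / η)⌋ ∈ Finset.Icc (-⌈4 * (2 / η)⌉) ⌈4 * (2 / η)⌉ := by
    intro θ hθ
    have hc : (0 : ℝ) < 2 / η := by positivity
    have hle := abs_le.1 (hθ.trans Real.pi_lt_four.le)
    rw [Finset.mem_Icc]
    constructor
    · rw [Int.le_floor]
      push_cast
      nlinarith [Int.le_ceil (4 * (2 / η))]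
    · exact (Int.floor_le_floor (mul_le_mul_of_nonneg_right hle.2 hc.le)).trans
        (Int.floor_le_ceil _)
  refine ⟨⌈4 * (2 / η)⌉, fun v => ⟨⌊(toComplex v).arg * (2 / η)⌋, hbd _ (Complex.abs_arg_le_pi _)⟩,
    fun v w hvw => ?_⟩
  have h1 := Int.abs_sub_lt_one_of_floor_eq_floor (congrArg Subtype.val hvw).symm
  rw [← sub_mul, abs_mul, abs_of_pos (show (0 : ℝ) < 2 / η by positivity), ← mul_div_assoc,
    div_lt_one hη] at h1
  have := aligned_of_arg (δ := η / 2) (v := v) (w := w) (by linarith) (by linarith)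
  rwa [mul_div_cancel₀ _ (two_ne_zero' ℝ)] at this

theorem satisfiesBCP_epsDist {ε : ℝ} (hε : 0 < ε) : SatisfiesBCP (epsDist ε) := by
  have hhom := isHomogeneousDistance_epsDist hε.le
  obtain ⟨η, hη, hη2, hηε⟩ : ∃ η : ℝ, 0 < η ∧ η ≤ 1 / 2 ∧ 8 * η ≤ ε ^ 2 :=
    ⟨min (1 / 2) (ε ^ 2 / 8), by positivity, min_le_left _ _,
      by linarith [min_le_right (1 / 2) (ε ^ 2 / 8)]⟩
  obtain ⟨K, hK⟩ := exists_nat_ge (ε ^ 2 + 3)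
  obtain ⟨m, sector, hsector⟩ := exists_sectors hη hη2
  choose slope hslope using exists_hasSlope K
  have hdist : ∀ o p : Heisenberg, epsDist ε p o = epsGauge ε (o⁻¹ * p) :=
    fun o p => hhom.isDistance.symm p o
  let color : Heisenberg → Prop × Fin (K + 1) × Finset.Icc (-m) m :=
    fun p => (0 ≤ p.z, slope p, sector p.v)
  refine satisfiesBCP_of_finite_coloring hhom.isDistance (fun o p => color (o⁻¹ * p)) ?_
  intro o p q hpq
  rw [← hhom.left_invariant o⁻¹ p q, hdist o p, hdist o q]
  generalize o⁻¹ * p = p at *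
  generalize o⁻¹ * q = q at *
  simp only [color, Prod.mk.injEq, eq_iff_iff] at hpq
  obtain ⟨hsign, hsl, hsec⟩ := hpq
  have hal := hsector _ _ hsec
  have hp := hslope p
  have hq := hslope q
  rw [← hsl] at hq
  have hz : 0 ≤ p.z * q.z := by
    by_cases h0 : 0 ≤ p.z
    · exact mul_nonneg h0 (hsign.1 h0)
    · exact mul_nonneg_of_nonpos_of_nonpos (not_le.1 h0).le
        (not_le.1 (fun h1 => h0 (hsign.2 h1))).le
  have hz' : 0 ≤ q.z * p.z := by rwa [mul_comm]
  have hsymm := hhom.isDistance.symm p q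
  rcases (Nat.lt_succ_iff.1 (slope p).2).lt_or_eq with hk | hk
  · rcases le_total ‖q.v‖ ‖p.v‖ with hv | hv
    · exact Or.inl (epsDist_le_of_hasSlope_lt hη hη2 hηε hal hz hk hp hq hv)
    · rw [hsymm]
      exact Or.inr (epsDist_le_of_hasSlope_lt hη hη2 hηε hal.symm hz' hk hq hp hv)
  · rw [hk] at hp hq
    rcases le_total |q.z| |p.z| with hv | hv
    · exact Or.inl (epsDist_le_of_hasSlope_self hη hη2 hηε hal hz hK hq hv)
    · rw [hsymm]
      exact Or.inr (epsDist_le_of_hasSlope_self hη hη2 hηε hal.symm hz' hK hp hv)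

/-! ### Failure of the covering property for the Korányi distance -/

/-- The point `((1, -x), 4 n⁴)`. -/
def slantedPoint (n x : ℝ) : Heisenberg := ⟨!₂[1, -x], 4 * n ^ 4⟩

theorem koranyiDist_one_right (p : Heisenberg) : koranyiDist p 1 = koranyiGauge p := by
  rw [koranyiDist, mul_one, koranyiGauge_inv]

theorem koranyiGauge_lt {p q : Heisenberg}
    (h : (p.v 0 ^ 2 + p.v 1 ^ 2) ^ 2 + 16 * p.z ^ 2 < (q.v 0 ^ 2 + q.v 1 ^ 2) ^ 2 + 16 * q.z ^ 2) :
    koranyiGauge p < koranyiGauge q := by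
  rw [← norm_sq_eq_coord, ← norm_sq_eq_coord, ← pow_mul, ← pow_mul] at h
  exact Real.rpow_lt_rpow (by positivity) h (by norm_num)

theorem koranyiGauge_slantedPoint_lt (n : ℝ) {x y : ℝ} (hy : 0 ≤ y) (hyx : y < x) :
    koranyiGauge (slantedPoint n y) < koranyiGauge (slantedPoint n x) := by
  apply koranyiGauge_lt
  simp only [slantedPoint, PiLp.toLp_apply, Matrix.cons_val_zero, Matrix.cons_val_one]
  have : y ^ 2 < x ^ 2 := pow_lt_pow_left₀ hyx hy two_ne_zero
  nlinarith [sq_nonneg y]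

/-- Compare fourth powers. The horizontal part loses at most `24 μ n⁴` (`hAB`). The twist `μ (x - y)
≥ μ` adds at least `μ / 4` to a height of size `4 n⁴`, so `16 z²` gains at least `32 μ n⁴` (`hD`).
-/
theorem koranyiGauge_lt_koranyiDist_slantedPoint {n x y μ : ℝ} (hn : 1 ≤ n) (hy : 0 ≤ y)
    (hyx : y + 1 ≤ x) (hx : x ≤ n) (hμ : 0 < μ) (hμn : 16 * n ^ 4 * μ ≤ 1) :
    koranyiGauge (slantedPoint n x) <
      koranyiDist (slantedPoint n x) (dilation μ (slantedPoint n y)) := by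
  apply koranyiGauge_lt
  simp only [slantedPoint, dilation, omega, mul_v, mul_z, inv_v, inv_z, PiLp.add_apply,
    PiLp.neg_apply, PiLp.smul_apply, smul_eq_mul, PiLp.toLp_apply, Matrix.cons_val_zero,
    Matrix.cons_val_one]
  have hn4 : 1 ≤ n ^ 4 := one_le_pow₀ hn
  have hμ1 : μ ≤ 1 := by nlinarith
  have hn2 : 1 ≤ n ^ 2 := one_le_pow₀ hn
  have hxy : x * y ≤ n ^ 2 := by nlinarith
  have hxy0 : 0 ≤ x * y := mul_nonneg (by linarith) hy
  have hx2 : x ^ 2 ≤ n ^ 2 := pow_le_pow_left₀ (by linarith) hx 2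
  have hy2 : y ^ 2 ≤ n ^ 2 := pow_le_pow_left₀ hy (by linarith) 2
  have hμ2 : μ ^ 2 ≤ 1 := by nlinarith
  have hA : -(4 * μ * n ^ 2) ≤ μ ^ 2 * (1 + y ^ 2) - 2 * μ * (1 + x * y) := by
    nlinarith [sq_nonneg μ, mul_nonneg (sq_nonneg μ) (sq_nonneg y)]
  have hB0 : 0 ≤ 2 * (1 + x ^ 2) + μ ^ 2 * (1 + y ^ 2) - 2 * μ * (1 + x * y) := by
    nlinarith [sq_nonneg (x - μ * y), sq_nonneg (1 - μ), sq_nonneg x]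
  have hB : 2 * (1 + x ^ 2) + μ ^ 2 * (1 + y ^ 2) - 2 * μ * (1 + x * y) ≤ 6 * n ^ 2 := by
    have h1 : μ ^ 2 * (1 + y ^ 2) ≤ 1 * (1 + y ^ 2) :=
      mul_le_mul_of_nonneg_right hμ2 (by positivity)
    have h2 : 0 ≤ μ * (1 + x * y) := by positivity
    linarith
  have hAB : -(24 * μ * n ^ 4) ≤ (μ ^ 2 * (1 + y ^ 2) - 2 * μ * (1 + x * y)) *
      (2 * (1 + x ^ 2) + μ ^ 2 * (1 + y ^ 2) - 2 * μ * (1 + x * y)) := by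
    have h1 := mul_le_mul_of_nonneg_right hA hB0
    have h2 := mul_le_mul_of_nonneg_left hB (by positivity : 0 ≤ 4 * μ * n ^ 2)
    nlinarith
  have hC : μ / 4 ≤ μ * (x - y) / 2 - 4 * n ^ 4 * μ ^ 2 := by nlinarith
  have hD : 8 * n ^ 4 * (μ / 4) ≤ (μ * (x - y) / 2 - 4 * n ^ 4 * μ ^ 2) *
      (8 * n ^ 4 + (μ * (x - y) / 2 - 4 * n ^ 4 * μ ^ 2)) := by
    nlinarith [mul_le_mul_of_nonneg_right hC (by positivity : 0 ≤ 8 * n ^ 4)]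
  have hpos : 0 < μ * n ^ 4 := by positivity
  nlinarith

theorem not_satisfiesBCP_koranyiDist : ¬ SatisfiesBCP koranyiDist := by
  have hhom := isHomogeneousDistance_koranyiDist
  refine not_satisfiesBCP_of_forall_points hhom.isDistance 1 fun n hn => ?_
  have hn' : (1 : ℝ) ≤ n := by exact_mod_cast hn
  -- With this ratio of consecutive scales, `μ = L ^ (-(i - j))` satisfies `16 n⁴ μ ≤ 1` for all `j
  -- < i`.
  set L : ℝ := 16 * (n : ℝ) ^ 4 with hL
  have hL1 : 1 ≤ L := by
    have := one_le_pow₀ (n := 4) hn'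
    linarith
  have hL0 : 0 < L := by linarith
  have hgauge : ∀ i : ℕ, koranyiGauge (dilation (L ^ i) (slantedPoint n i))
      = L ^ i * koranyiGauge (slantedPoint n i) := fun i => koranyiGauge_dilation (by positivity) _
  have hlt : ∀ i ≤ n, ∀ j < i, koranyiGauge (dilation (L ^ i) (slantedPoint n i)) <
      koranyiDist (dilation (L ^ i) (slantedPoint n i)) (dilation (L ^ j) (slantedPoint n j)) := by
    intro i hi j hji
    have hij : L ^ j = L ^ i * (L ^ (i - j))⁻¹ := by
      rw [← pow_sub_mul_pow L hji.le]
      field_simp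
    rw [hgauge, hij, ← dilation_dilation, hhom.homogeneous _ (by positivity)]
    refine mul_lt_mul_of_pos_left (koranyiGauge_lt_koranyiDist_slantedPoint hn' (Nat.cast_nonneg j)
      (by exact_mod_cast hji) (by exact_mod_cast hi) (by positivity) ?_) (by positivity)
    rw [← hL, ← div_eq_mul_inv, div_le_one (by positivity)]
    exact le_self_pow₀ hL1 (by omega)
  -- The larger-scale point has the larger gauge, so `hlt` also settles pairs in the opposite order.
  have hmono : ∀ i j : ℕ, j < i → koranyiGauge (dilation (L ^ j) (slantedPoint n j)) ≤
      koranyiGauge (dilation (L ^ i) (slantedPoint n i)) := by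
    intro i j hji
    rw [hgauge, hgauge]
    exact mul_le_mul (pow_le_pow_right₀ hL1 hji.le)
      (koranyiGauge_slantedPoint_lt n (Nat.cast_nonneg j) (by exact_mod_cast hji)).le
      (koranyiGauge_nonneg _) (by positivity)
  refine ⟨fun i => dilation (L ^ i) (slantedPoint n i), fun i => ?_, fun i hi j hj hij => ?_⟩
  · rw [koranyiDist_one_right, hgauge]
    refine mul_pos (by positivity) (lt_of_le_of_ne (koranyiGauge_nonneg _) (Ne.symm ?_))
    rw [Ne, koranyiGauge_eq_zero_iff]
    intro h
    have h0 := congrArg (fun p => p.v 0) h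
    simp [slantedPoint] at h0
  · rw [koranyiDist_one_right]
    rcases lt_or_gt_of_ne hij with h | h
    · rw [hhom.isDistance.symm]
      exact (hmono j i h).trans_lt (hlt j hj i h)
    · exact hlt i hi j h

end Heisenberg

theorem theorem1p5 :
    (∀ ε : ℝ, 0 < ε →
      Heisenberg.IsHomogeneousDistance (Heisenberg.epsDist ε) ∧
      SatisfiesBCP (Heisenberg.epsDist ε) ∧
      ∀ p q : Heisenberg,
        Heisenberg.koranyiDist p q ≤ Heisenberg.epsDist ε p q ∧
        Heisenberg.epsDist ε p q ≤ (1 + ε) * Heisenberg.koranyiDist p q) ∧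
    Heisenberg.IsHomogeneousDistance Heisenberg.koranyiDist ∧
    ¬ SatisfiesBCP Heisenberg.koranyiDist := by
  refine ⟨fun ε hε => ⟨Heisenberg.isHomogeneousDistance_epsDist hε.le,
    Heisenberg.satisfiesBCP_epsDist hε, fun p q => ⟨?_, ?_⟩⟩,
    Heisenberg.isHomogeneousDistance_koranyiDist, Heisenberg.not_satisfiesBCP_koranyiDist⟩
  · exact Heisenberg.koranyiGauge_le_epsGauge ε _
  · exact Heisenberg.epsGauge_le hε.le _
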